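/- Let $\mathbb F$ be a field. Let $\mathbf{Assoc}$ be the category of associative (not necessarily unital) $\mathbb F$-algebras, with the linear multiplicative maps as morphisms, and let $\mathbf{CAssoc}$ be its full subcategory of commutative associative algebras. An \emph{amalgam} of a diagram in a category is a cocone on that diagram all of whose components are monomorphisms. Let $S \xleftarrow{s} I \xrightarrow{t} T$ be a span in $\mathbf{CAssoc}$. (a) If the span admits an amalgam in $\mathbf{Assoc}$, then it admits an amalgam in $\mathbf{CAssoc}$. (b) Monicity of the pushout injections is preserved on passing to the commutative pushout: let $\iota_S\colon S\to S+_I^{\mathbf{Assoc}}T$ and $\iota_T\colon T\to S+_I^{\mathbf{Assoc}}T$ be the injections of the pushout of the span in $\mathbf{Assoc}$, and $\kappa_S\colon S\to S+_I^{\mathbf{CAssoc}}T$ and $\kappa_T\colon T\to S+_I^{\mathbf{CAssoc}}T$ those of its pushout in $\mathbf{CAssoc}$. If $\iota_S$ is a monomorphism, then so is $\kappa_S$; and if $\iota_T$ is a monomorphism, then so is $\kappa_T$. -/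

import Mathlib

open CategoryTheory CategoryTheory.Limits

universe u v

/-- An object of the category of associative algebras over the field `F`: an `F`-vector space
with a bilinear associative multiplication; a unit element is not required. -/
structure Assoc (F : Type u) [Field F] where
  carrier : Type v
  [ring : NonUnitalRing carrier]
  [module : Module F carrier]
  [isScalarTower : IsScalarTower F carrier carrier]
  [smulCommClass : SMulCommClass F carrier carrier]

/-- An object of the category of commutative associative algebras over the field `F`: an
`F`-vector space with a bilinear, associative and commutative multiplication; a unit element is
not required. -/
structure CAssoc (F : Type u) [Field F] where
  carrier : Type v
  [ring : NonUnitalCommRing carrier]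
  [module : Module F carrier]
  [isScalarTower : IsScalarTower F carrier carrier]
  [smulCommClass : SMulCommClass F carrier carrier]

attribute [instance] Assoc.ring Assoc.module Assoc.isScalarTower Assoc.smulCommClass
attribute [instance] CAssoc.ring CAssoc.module CAssoc.isScalarTower CAssoc.smulCommClass

/-- Morphisms of associative algebras are the linear maps that preserve the multiplication. -/
instance Assoc.category (F : Type u) [Field F] : Category.{v} (Assoc.{u, v} F) where
  Hom A B := A.carrier →ₙₐ[F] B.carrier
  id A := NonUnitalAlgHom.id F A.carrier
  comp f g := NonUnitalAlgHom.comp g f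

/-- Morphisms of commutative associative algebras are the linear maps that preserve the
multiplication. -/
instance CAssoc.category (F : Type u) [Field F] : Category.{v} (CAssoc.{u, v} F) where
  Hom A B := A.carrier →ₙₐ[F] B.carrier
  id A := NonUnitalAlgHom.id F A.carrier
  comp f g := NonUnitalAlgHom.comp g f

/-- The forgetful functor from commutative associative algebras to associative algebras. -/
def CAssoc.U (F : Type u) [Field F] : CAssoc.{u, v} F ⥤ Assoc.{u, v} F where
  obj A := { carrier := A.carrier }
  map f := f

/-- An amalgam for a diagram `D` is a monic cocone, that is, a cocone on `D` each of whose
components is a monomorphism. -/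
def HasAmalgam {J : Type*} [Category J] {C : Type*} [Category C] (D : J ⥤ C) : Prop :=
  ∃ c : Cocone D, ∀ j : J, Mono (c.ι.app j)

/-! Let `ιS : S → P` and `ιT : T → P` form a cocone in associative algebras over a span of
commutative ones. After adjoining units, consider the linear map `μ : S ⊗ T → P`,
`x ⊗ y ↦ ιS x * ιT y`. It is not multiplicative, as the values of `ιS` and `ιT` need not commute,
but `μ ((x ⊗ y) * z) = ιS x * μ z * ιT y` because `T` is commutative, and so its kernel is still an
ideal. The quotient by this ideal is a commutative algebra that `μ` embeds linearly into `P`, and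
the embedding takes the images of `a ∈ S` and `b ∈ T` to `ιS a` and `ιT b`. Hence the maps from `S`
and `T` to the quotient form a cocone again, and they are injective wherever `ιS` and `ιT` are. -/

open scoped TensorProduct

section MulTensor

variable {F X Y P : Type*} [CommSemiring F] [Semiring X] [Algebra F X] [Semiring P] [Algebra F P]

/-- The linear map `x ⊗ y ↦ f x * g y`. In contrast to `Algebra.TensorProduct.lift`, the values of
`f` and `g` are not assumed to commute, so that it is not multiplicative in general. -/
noncomputable def mulTensor [Semiring Y] [Algebra F Y] (f : X →ₐ[F] P) (g : Y →ₐ[F] P) :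
    X ⊗[F] Y →ₗ[F] P :=
  LinearMap.mul' F P ∘ₗ TensorProduct.map f.toLinearMap g.toLinearMap

@[simp]
theorem mulTensor_tmul [Semiring Y] [Algebra F Y] (f : X →ₐ[F] P) (g : Y →ₐ[F] P) (x : X) (y : Y) :
    mulTensor f g (x ⊗ₜ y) = f x * g y :=
  rfl

variable [CommSemiring Y] [Algebra F Y] (f : X →ₐ[F] P) (g : Y →ₐ[F] P)

theorem mulTensor_tmul_mul (x : X) (y : Y) (z : X ⊗[F] Y) :
    mulTensor f g (x ⊗ₜ y * z) = f x * mulTensor f g z * g y := by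
  induction z with
  | zero => simp
  | add z w hz hw => simp only [mul_add, map_add, add_mul, hz, hw]
  | tmul x' y' =>
    rw [Algebra.TensorProduct.tmul_mul_tmul, mul_comm y]
    simp only [mulTensor_tmul, map_mul, mul_assoc]

/-- The kernel of `mulTensor f g`, as an ideal. -/
noncomputable def mulTensorKer : Ideal (X ⊗[F] Y) where
  __ := LinearMap.ker (mulTensor f g)
  smul_mem' w z (hz : mulTensor f g z = 0) := by
    change mulTensor f g (w * z) = 0
    induction w with
    | zero => simp
    | add v w hv hw => rw [add_mul, map_add, hv, hw, add_zero]
    | tmul x y => rw [mulTensor_tmul_mul, hz, mul_zero, zero_mul]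

end MulTensor

section CommProduct

variable {F X Y P : Type*} [CommRing F] [CommRing X] [Algebra F X] [CommRing Y] [Algebra F Y]
  [Ring P] [Algebra F P] (f : X →ₐ[F] P) (g : Y →ₐ[F] P)

/-- The linear span of the products `f x * g y`, made into a commutative algebra by
`(f x * g y) * (f x' * g y') = f (x * x') * g (y * y')`, which is in general not the product of
`P`. It is encoded as a quotient of `X ⊗[F] Y`. -/
abbrev CommProduct : Type _ := (X ⊗[F] Y) ⧸ mulTensorKer f g

namespace CommProduct

/-- The inclusion of the linear span of the products `f x * g y` into `P`, which is linear, but in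
general not multiplicative. -/
noncomputable def toAmbient : CommProduct f g →ₗ[F] P :=
  ((mulTensorKer f g).restrictScalars F).liftQ (mulTensor f g) le_rfl ∘ₗ
    (Submodule.Quotient.restrictScalarsEquiv F (mulTensorKer f g)).symm.toLinearMap

theorem toAmbient_injective : Function.Injective (toAmbient f g) :=
  (LinearMap.ker_eq_bot.mp (Submodule.ker_liftQ_eq_bot _ _ le_rfl le_rfl)).comp
    (LinearEquiv.injective _)

/-- The map `X → CommProduct f g` that corresponds to `f`. -/
noncomputable def includeLeft : X →ₐ[F] CommProduct f g :=
  (Ideal.Quotient.mkₐ F (mulTensorKer f g)).comp Algebra.TensorProduct.includeLeft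

/-- The map `Y → CommProduct f g` that corresponds to `g`. -/
noncomputable def includeRight : Y →ₐ[F] CommProduct f g :=
  (Ideal.Quotient.mkₐ F (mulTensorKer f g)).comp Algebra.TensorProduct.includeRight

@[simp]
theorem toAmbient_includeLeft (x : X) : toAmbient f g (includeLeft f g x) = f x :=
  (mulTensor_tmul f g x 1).trans (by rw [map_one, mul_one])

@[simp]
theorem toAmbient_includeRight (y : Y) : toAmbient f g (includeRight f g y) = g y :=
  (mulTensor_tmul f g 1 y).trans (by rw [map_one, one_mul])

end CommProduct

end CommProduct

section UnitizationMap

variable {F S P : Type*} [CommSemiring F] [NonUnitalSemiring S] [Module F S]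
  [IsScalarTower F S S] [SMulCommClass F S S] [NonUnitalSemiring P] [Module F P]
  [IsScalarTower F P P] [SMulCommClass F P P] (φ : S →ₙₐ[F] P)

/-- The unital extension of an algebra homomorphism to the unitizations; it is
`Unitization.starMap` without the star structure. -/
noncomputable def unitizationMap : Unitization F S →ₐ[F] Unitization F P :=
  Unitization.lift ((Unitization.inrNonUnitalAlgHom F P).comp φ)

@[simp]
theorem unitizationMap_inr (a : S) :
    unitizationMap φ (a : Unitization F S) = (φ a : Unitization F P) := by
  simp [unitizationMap]

end UnitizationMap

theorem small_unitization_of_nontrivial (F : Type u) (P : Type v) [DivisionRing F] [AddCommGroup P]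
    [Module F P] [Nontrivial P] : Small.{v} (Unitization F P) := by
  obtain ⟨p, hp⟩ := exists_ne (0 : P)
  have : Small.{v} F := small_of_injective (smul_left_injective F hp)
  exact small_map Unitization.equiv

section Categories

variable {F : Type u} [Field F]

instance Assoc.concreteCategory :
    ConcreteCategory (Assoc.{u, v} F) fun A B => A.carrier →ₙₐ[F] B.carrier where
  hom f := f
  ofHom f := f

instance CAssoc.concreteCategory :
    ConcreteCategory (CAssoc.{u, v} F) fun A B => A.carrier →ₙₐ[F] B.carrier where
  hom f := f
  ofHom f := f

instance CAssoc.faithful_U : (CAssoc.U.{u, v} F).Faithful where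
  map_injective h := h

theorem Assoc.injective_of_mono {A B : Assoc.{u, v} F} (f : A ⟶ B) [Mono f] :
    Function.Injective f := by
  intro a b hab
  let fst := NonUnitalAlgHom.fst F A.carrier A.carrier
  let snd := NonUnitalAlgHom.snd F A.carrier A.carrier
  let K := NonUnitalAlgHom.equalizer
    ((ConcreteCategory.hom f).comp fst) ((ConcreteCategory.hom f).comp snd)
  let p : (⟨K⟩ : Assoc.{u, v} F) ⟶ A := fst.comp (NonUnitalSubalgebraClass.subtype K)
  let q : (⟨K⟩ : Assoc.{u, v} F) ⟶ A := snd.comp (NonUnitalSubalgebraClass.subtype K)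
  have p_comp_eq : p ≫ f = q ≫ f := ConcreteCategory.hom_ext _ _ fun x => x.2
  have p_eq_q : p = q := (cancel_mono f).mp p_comp_eq
  exact ConcreteCategory.congr_hom p_eq_q ⟨(a, b), hab⟩

theorem CAssoc.exists_linear_embedding {S T : CAssoc.{u, v} F} {P : Assoc.{u, v} F}
    (ιS : (CAssoc.U F).obj S ⟶ P) (ιT : (CAssoc.U F).obj T ⟶ P) :
    ∃ (Q : CAssoc.{u, v} F) (κS : S ⟶ Q) (κT : T ⟶ Q)
      (ν : Q.carrier →ₗ[F] Unitization F P.carrier), Function.Injective ν ∧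
        (∀ a, ν (κS a) = (ιS a : P.carrier)) ∧ ∀ b, ν (κT b) = (ιT b : P.carrier) := by
  -- If `F` does not fit into the universe of `P`, then `P` is zero.
  obtain _ | _ := subsingleton_or_nontrivial P.carrier
  · exact ⟨⟨PUnit⟩, (0 : S.carrier →ₙₐ[F] PUnit), (0 : T.carrier →ₙₐ[F] PUnit), 0,
      Function.injective_of_subsingleton _, fun a => by simp [Subsingleton.elim (ιS a) 0],
      fun b => by simp [Subsingleton.elim (ιT b) 0]⟩
  let f : Unitization F S.carrier →ₐ[F] Unitization F P.carrier :=
    unitizationMap (ConcreteCategory.hom ιS)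
  let g : Unitization F T.carrier →ₐ[F] Unitization F P.carrier :=
    unitizationMap (ConcreteCategory.hom ιT)
  have := small_unitization_of_nontrivial F P.carrier
  have : Small.{v} (CommProduct f g) := small_of_injective (CommProduct.toAmbient_injective f g)
  let e : Shrink.{v} (CommProduct f g) ≃ₐ[F] CommProduct f g := Shrink.algEquiv F _
  refine ⟨{ carrier := Shrink.{v} (CommProduct f g), module := Algebra.toModule },
    Unitization.lift.symm ((e.symm : _ →ₐ[F] _).comp (CommProduct.includeLeft f g)),
    Unitization.lift.symm ((e.symm : _ →ₐ[F] _).comp (CommProduct.includeRight f g)),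
    CommProduct.toAmbient f g ∘ₗ e.toLinearMap,
    (CommProduct.toAmbient_injective f g).comp e.injective, fun a => ?_, fun b => ?_⟩
  · calc
      CommProduct.toAmbient f g (e (e.symm (CommProduct.includeLeft f g a))) = f a := by
        rw [e.apply_symm_apply, CommProduct.toAmbient_includeLeft]
      _ = (ιS a : P.carrier) := unitizationMap_inr _ a
  · calc
      CommProduct.toAmbient f g (e (e.symm (CommProduct.includeRight f g b))) = g b := by
        rw [e.apply_symm_apply, CommProduct.toAmbient_includeRight]
      _ = (ιT b : P.carrier) := unitizationMap_inr _ b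

theorem CAssoc.exists_commSq_mono_of_mono {I S T : CAssoc.{u, v} F} {s : I ⟶ S} {t : I ⟶ T}
    {P : Assoc.{u, v} F} {ιS : (CAssoc.U F).obj S ⟶ P} {ιT : (CAssoc.U F).obj T ⟶ P}
    (sq : CommSq ((CAssoc.U F).map s) ((CAssoc.U F).map t) ιS ιT) :
    ∃ (Q : CAssoc.{u, v} F) (κS : S ⟶ Q) (κT : T ⟶ Q),
      CommSq s t κS κT ∧ (Mono ιS → Mono κS) ∧ (Mono ιT → Mono κT) := by
  obtain ⟨Q, κS, κT, ν, ν_injective, ν_κS, ν_κT⟩ := CAssoc.exists_linear_embedding ιS ιT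
  refine ⟨Q, κS, κT, ⟨ConcreteCategory.hom_ext _ _ fun i => ν_injective ?_⟩,
    fun _ => ConcreteCategory.mono_of_injective κS fun a b hab => ?_,
    fun _ => ConcreteCategory.mono_of_injective κT fun a b hab => ?_⟩
  · have ιS_s_eq : ιS (s i) = ιT (t i) := ConcreteCategory.congr_hom sq.w i
    rw [ConcreteCategory.comp_apply, ConcreteCategory.comp_apply, ν_κS, ν_κT, ιS_s_eq]
  · exact Assoc.injective_of_mono ιS (Unitization.inr_injective (by rw [← ν_κS, ← ν_κS, hab]))
  · exact Assoc.injective_of_mono ιT (Unitization.inr_injective (by rw [← ν_κT, ← ν_κT, hab]))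

end Categories

section Amalgam

variable {C D : Type*} [Category* C] [Category* D] {X Y Z : C} {f : X ⟶ Y} {g : X ⟶ Z}

theorem HasAmalgam.of_commSq {W : C} {inl : Y ⟶ W} {inr : Z ⟶ W} (sq : CommSq f g inl inr)
    [Mono f] [Mono inl] [Mono inr] : HasAmalgam (span f g) :=
  ⟨PushoutCocone.mk inl inr sq.w, by
    rintro (_ | _ | _)
    exacts [mono_comp f inl, ‹Mono inl›, ‹Mono inr›]⟩

theorem HasAmalgam.exists_commSq {G : C ⥤ D} (h : HasAmalgam (span f g ⋙ G)) :
    ∃ (P : D) (inl : G.obj Y ⟶ P) (inr : G.obj Z ⟶ P),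
      CommSq (G.map f) (G.map g) inl inr ∧ Mono (G.map f) ∧ Mono inl ∧ Mono inr := by
  obtain ⟨c, hc⟩ := h
  let inl : G.obj Y ⟶ c.pt := c.ι.app WalkingSpan.left
  let inr : G.obj Z ⟶ c.pt := c.ι.app WalkingSpan.right
  have f_inl : G.map f ≫ inl = c.ι.app WalkingSpan.zero := c.w WalkingSpan.Hom.fst
  have g_inr : G.map g ≫ inr = c.ι.app WalkingSpan.zero := c.w WalkingSpan.Hom.snd
  have : Mono (G.map f ≫ inl) := f_inl ▸ hc WalkingSpan.zero
  exact ⟨c.pt, inl, inr, ⟨f_inl.trans g_inr.symm⟩, mono_of_mono _ inl,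
    hc WalkingSpan.left, hc WalkingSpan.right⟩

end Amalgam

theorem mainTheorem2 {F : Type u} [Field F] {I S T : CAssoc.{u, v} F} (s : I ⟶ S) (t : I ⟶ T) :
    (HasAmalgam (span s t ⋙ CAssoc.U F) → HasAmalgam (span s t)) ∧
    (∀ (P : Assoc.{u, v} F) (ιS : (CAssoc.U F).obj S ⟶ P) (ιT : (CAssoc.U F).obj T ⟶ P)
        (Q : CAssoc.{u, v} F) (κS : S ⟶ Q) (κT : T ⟶ Q),
      IsPushout ((CAssoc.U F).map s) ((CAssoc.U F).map t) ιS ιT →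
      IsPushout s t κS κT →
      (Mono ιS → Mono κS) ∧ (Mono ιT → Mono κT)) := by
  constructor
  · intro h
    obtain ⟨P, ιS, ιT, sq, mono_s, mono_ιS, mono_ιT⟩ := h.exists_commSq
    obtain ⟨Q, κS, κT, sq', mono_κS, mono_κT⟩ := CAssoc.exists_commSq_mono_of_mono sq
    have := (CAssoc.U F).mono_of_mono_map mono_s
    have := mono_κS mono_ιS
    have := mono_κT mono_ιT
    exact HasAmalgam.of_commSq sq'
  · intro P ιS ιT Q κS κT hP hQ
    obtain ⟨Q', κS', κT', sq, mono_κS', mono_κT'⟩ := CAssoc.exists_commSq_mono_of_mono hP.toCommSq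
    constructor
    · intro mono_ιS
      have := mono_κS' mono_ιS
      exact mono_of_mono_fac (hQ.inl_desc κS' κT' sq.w)
    · intro mono_ιT
      have := mono_κT' mono_ιT
      exact mono_of_mono_fac (hQ.inr_desc κS' κT' sq.w)
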